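/- Let $a$, $b$, $c$ be three distinct letters of an alphabet $\Sigma$. An ordinary (context-free) grammar over $\Sigma$ is \emph{unambiguous} if every word has at most one parse tree in it (with the initial symbol at the root). A language is \emph{inherently ambiguous} if it is described by some ordinary grammar, but by no unambiguous ordinary grammar. A \emph{GF(2)-grammar} over $\Sigma$ is given by an ordinary grammar over $\Sigma$ in which every word $w\in\Sigma^*$ has only finitely many parse trees; the language it describes is the set of all words that have an odd number of parse trees. Corollary. The language $\{a^n b^m c^\ell \mid n, m, \ell \geq 0,\ n \neq m \text{ or } m \neq \ell\}$ is not described by any GF(2)-grammar. Moreover, it is inherently ambiguous. -/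

import Mathlib

namespace ContextFreeGrammar

/-- `g.ParseForest [X₁, …, X_ℓ]` is the type of sequences of `ℓ` parse trees of the grammar `g`, the
`i`-th of which is a parse tree as the symbol `X_i`: a single leaf if `X_i` is a terminal; and if
`X_i` is a nonterminal, a root labelled by a rule of `g` for that nonterminal, together with the
sequence of its subtrees, which are parse trees as the symbols on the right-hand side of the rule. -/
inductive ParseForest {T : Type*} (g : ContextFreeGrammar T) : List (Symbol T g.NT) → Type _
  | nil : ParseForest g []
  | leaf (x : T) {s : List (Symbol T g.NT)} (rest : ParseForest g s) :
      ParseForest g (Symbol.terminal x :: s)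
  | node (r : ContextFreeRule T g.NT) (hr : r ∈ g.rules) (children : ParseForest g r.output)
      {s : List (Symbol T g.NT)} (rest : ParseForest g s) :
      ParseForest g (Symbol.nonterminal r.input :: s)

/-- The word formed by the leaves of a sequence of parse trees, read from left to right. -/
def ParseForest.yield {T : Type*} {g : ContextFreeGrammar T} :
    {s : List (Symbol T g.NT)} → g.ParseForest s → List T
  | _, .nil => []
  | _, .leaf x rest => x :: rest.yield
  | _, .node _ _ children rest => children.yield ++ rest.yield

/-- The parse trees of the word `w` as the nonterminal `A`. -/
def ParseTree {T : Type*} (g : ContextFreeGrammar T) (A : g.NT) (w : List T) : Type _ :=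
  {t : g.ParseForest [Symbol.nonterminal A] // t.yield = w}

/-- An (ordinary) grammar is unambiguous if every word has at most one parse tree as the initial
symbol. -/
def IsUnambiguous {T : Type*} (g : ContextFreeGrammar T) : Prop :=
  ∀ w : List T, Subsingleton (g.ParseTree g.initial w)

end ContextFreeGrammar

/-- A language is inherently ambiguous if it is described by some ordinary grammar, but by no
unambiguous one. -/
def Language.IsInherentlyAmbiguous {T : Type*} (L : Language T) : Prop :=
  L.IsContextFree ∧ ∀ g : ContextFreeGrammar T, g.language = L → ¬ g.IsUnambiguous

/-- A GF(2)-grammar: syntactically an ordinary grammar, in which every word is required to have only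
finitely many parse trees. A rule `A → X₁ … X_ℓ` stands for `A → X₁ ⊙ … ⊙ X_ℓ`. -/
structure GF2Grammar (T : Type*) where
  /-- The corresponding ordinary grammar. -/
  toCFG : ContextFreeGrammar T
  /-- Every word has finitely many parse trees as the initial symbol. -/
  finite_parseTree : ∀ w : List T, Finite (toCFG.ParseTree toCFG.initial w)

/-- The language described by a GF(2)-grammar: all words with an odd number of parse trees. -/
def GF2Grammar.language {T : Type*} (G : GF2Grammar T) : Language T :=
  {w : List T | Odd (Nat.card (G.toCFG.ParseTree G.toCFG.initial w))}

/-- The language `{aⁿ bᵐ c^ℓ | n ≠ m or m ≠ ℓ}`, where `n, m, ℓ ≥ 0`. -/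
def neOrNeLanguage {T : Type*} (a b c : T) : Language T :=
  {w : List T | ∃ n m l : ℕ, (n ≠ m ∨ m ≠ l) ∧
    w = List.replicate n a ++ List.replicate m b ++ List.replicate l c}

/-! Suppose a GF(2)-grammar describes the language. Count modulo two the parse trees of `aⁿ bᵐ c^ℓ`
by a power series in three variables over the two-element field. Since the sorted words missing from
the language are those with `n = m = ℓ`, the series is `1/((1-x)(1-y)(1-z)) - 1/(1-xyz)`. The
contradiction is that `1/(1-xyz)` cannot arise from a grammar.

Split the trees by the index of the letter at which a sorted run starts and ends. The series from
`p` to `p` are multiplicative in the string of symbols, and those from `p` to `q > p` satisfy a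
Leibniz rule up to terms through intermediate indices. Any quantity obeying such a rule and the
grammar rules, and vanishing on terminals, is zero (`eq_zero_of_leibniz`): its linear system has
invertible constant part, because finite ambiguity forbids cyclic derivations `A ⇒⁺ A`. For
derivations, this makes the diagonal series algebraic over the field of their own variable. In a
quotient by a subspace, it puts the series 0→1 and 1→2 in fields algebraic over two variables, and
the series 0→2 in the span of `z` and products of the former two kinds over elements algebraic over
`x, z`.

Now specialize to `xyz = 1`. No nonzero polynomial in only two variables vanishes, so everything
above is integral over the ring of fractions with denominators nonzero under this specialization
(`series_zero_mem_integralSubring`). But `1/(1-xyz)` is not (`notMem_integralSubring`), since units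
descend along integral extensions.

An unambiguous grammar is a GF(2)-grammar for the same language, so inherent ambiguity follows once
an ordinary grammar is exhibited. -/

namespace ContextFreeGrammar

/-! ### Parse forests and derivations. -/

variable {T : Type*} {g : ContextFreeGrammar T}

namespace ParseForest

/-- Put a parse tree in front of a sequence of parse trees. -/
def cons : {X : Symbol T g.NT} → {s : List (Symbol T g.NT)} →
    g.ParseForest [X] → g.ParseForest s → g.ParseForest (X :: s)
  | _, _, .leaf x .nil, f => .leaf x f
  | _, _, .node r hr ch .nil, f => .node r hr ch f

/-- The first parse tree of a nonempty sequence. -/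
def head : {X : Symbol T g.NT} → {s : List (Symbol T g.NT)} →
    g.ParseForest (X :: s) → g.ParseForest [X]
  | _, _, .leaf x _ => .leaf x .nil
  | _, _, .node r hr ch _ => .node r hr ch .nil

/-- All parse trees of a nonempty sequence but the first. -/
def tail : {X : Symbol T g.NT} → {s : List (Symbol T g.NT)} →
    g.ParseForest (X :: s) → g.ParseForest s
  | _, _, .leaf _ f => f
  | _, _, .node _ _ _ f => f

/-- The number of nodes that are labelled by rules. -/
def size : {s : List (Symbol T g.NT)} → g.ParseForest s → ℕ
  | _, .nil => 0
  | _, .leaf _ f => f.size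
  | _, .node _ _ ch f => ch.size + f.size + 1

@[simp] lemma head_cons {X : Symbol T g.NT} {s : List (Symbol T g.NT)} (t : g.ParseForest [X])
    (f : g.ParseForest s) : (cons t f).head = t := by
  match t with
  | .leaf x .nil => rfl
  | .node r hr ch .nil => rfl

@[simp] lemma tail_cons {X : Symbol T g.NT} {s : List (Symbol T g.NT)} (t : g.ParseForest [X])
    (f : g.ParseForest s) : (cons t f).tail = f := by
  match t with
  | .leaf x .nil => rfl
  | .node r hr ch .nil => rfl

@[simp] lemma cons_head_tail {X : Symbol T g.NT} {s : List (Symbol T g.NT)}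
    (f : g.ParseForest (X :: s)) : cons f.head f.tail = f := by
  match f with
  | .leaf x f => rfl
  | .node r hr ch f => rfl

@[simp] lemma yield_cons {X : Symbol T g.NT} {s : List (Symbol T g.NT)} (t : g.ParseForest [X])
    (f : g.ParseForest s) : (cons t f).yield = t.yield ++ f.yield := by
  match t with
  | .leaf x .nil => simp [cons, yield]
  | .node r hr ch .nil => simp [cons, yield]

lemma yield_eq_head_append_tail {X : Symbol T g.NT} {s : List (Symbol T g.NT)}
    (f : g.ParseForest (X :: s)) : f.yield = f.head.yield ++ f.tail.yield := by
  rw [← yield_cons, cons_head_tail]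

@[simp] lemma size_cons {X : Symbol T g.NT} {s : List (Symbol T g.NT)} (t : g.ParseForest [X])
    (f : g.ParseForest s) : (cons t f).size = t.size + f.size := by
  match t with
  | .leaf x .nil => simp [cons, size]
  | .node r hr ch .nil => simp [cons, size]; omega

lemma eq_nil (f : g.ParseForest []) : f = .nil := by cases f; rfl

lemma eq_leaf {x : T} (f : g.ParseForest [.terminal x]) : f = .leaf x .nil := by
  match f with
  | .leaf x .nil => rfl

/-- A parse tree as a nonterminal is a rule together with the sequence of subtrees. -/
def nodeEquiv (A : g.NT) : g.ParseForest [.nonterminal A] ≃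
    Σ r : {r : ContextFreeRule T g.NT // r ∈ g.rules ∧ r.input = A}, g.ParseForest r.1.output where
  toFun f := match f with
    | .node r hr ch .nil => ⟨⟨r, hr, rfl⟩, ch⟩
  invFun p := match A, p with
    | _, ⟨⟨r, hr, rfl⟩, ch⟩ => .node r hr ch .nil
  left_inv f := by
    match f with
    | .node r hr ch .nil => rfl
  right_inv p := by
    obtain ⟨⟨r, hr, rfl⟩, ch⟩ := p
    rfl

@[simp] lemma yield_nodeEquiv_symm {A : g.NT}
    (p : Σ r : {r : ContextFreeRule T g.NT // r ∈ g.rules ∧ r.input = A},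
      g.ParseForest r.1.output) : ((nodeEquiv A).symm p).yield = p.2.yield := by
  obtain ⟨⟨r, hr, rfl⟩, ch⟩ := p
  simp [nodeEquiv, yield]

@[simp] lemma size_nodeEquiv_symm {A : g.NT}
    (p : Σ r : {r : ContextFreeRule T g.NT // r ∈ g.rules ∧ r.input = A},
      g.ParseForest r.1.output) : ((nodeEquiv A).symm p).size = p.2.size + 1 := by
  obtain ⟨⟨r, hr, rfl⟩, ch⟩ := p
  simp [nodeEquiv, size]

lemma exists_append {s₁ s₂ : List (Symbol T g.NT)} (f₁ : g.ParseForest s₁) (f₂ : g.ParseForest s₂) :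
    ∃ f : g.ParseForest (s₁ ++ s₂), f.yield = f₁.yield ++ f₂.yield := by
  induction s₁ with
  | nil => cases f₁; exact ⟨f₂, by simp [yield]⟩
  | cons X s ih =>
    obtain ⟨f, hf⟩ := ih f₁.tail
    refine ⟨cons f₁.head f, ?_⟩
    rw [yield_cons, hf, ← List.append_assoc, ← yield_eq_head_append_tail]

lemma exists_split {s₁ s₂ : List (Symbol T g.NT)} (f : g.ParseForest (s₁ ++ s₂)) :
    ∃ (f₁ : g.ParseForest s₁) (f₂ : g.ParseForest s₂), f.yield = f₁.yield ++ f₂.yield := by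
  induction s₁ with
  | nil => exact ⟨.nil, f, by simp [yield]⟩
  | cons X s ih =>
    obtain ⟨f₁, f₂, hf⟩ := ih (tail (s := s ++ s₂) f)
    refine ⟨cons (head (s := s ++ s₂) f) f₁, f₂, ?_⟩
    conv_lhs => rw [← cons_head_tail (s := s ++ s₂) f]
    simp only [yield_cons, hf, List.append_assoc]

lemma derives_yield {s : List (Symbol T g.NT)} (f : g.ParseForest s) :
    g.Derives s (f.yield.map .terminal) := by
  induction f with
  | nil => exact Derives.refl _
  | leaf x f ih => simpa [yield] using ih.append_left [.terminal x]
  | node r hr ch f ihc ihf =>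
    rename_i s
    have h₁ : g.Produces (.nonterminal r.input :: s) (r.output ++ s) := ⟨r, hr, .head s⟩
    have h₂ := ihc.append_right s
    have h₃ := ihf.append_left (ch.yield.map .terminal)
    simpa [yield] using (h₁.single.trans h₂).trans h₃

end ParseForest

open ParseForest

lemma exists_parseForest_map_terminal (g : ContextFreeGrammar T) (w : List T) :
    ∃ f : g.ParseForest (w.map .terminal), f.yield = w := by
  induction w with
  | nil => exact ⟨.nil, rfl⟩
  | cons x w ih =>
    obtain ⟨f, hf⟩ := ih
    exact ⟨.leaf x f, by simp [yield, hf]⟩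

lemma derives_iff_exists_parseForest {s : List (Symbol T g.NT)} {w : List T} :
    g.Derives s (w.map .terminal) ↔ ∃ f : g.ParseForest s, f.yield = w := by
  refine ⟨fun h ↦ ?_, fun ⟨f, hf⟩ ↦ hf ▸ f.derives_yield⟩
  induction h using Relation.ReflTransGen.head_induction_on with
  | refl => exact g.exists_parseForest_map_terminal w
  | head h _ ih =>
    obtain ⟨r, hr, hrw⟩ := h
    obtain ⟨p, q, rfl, rfl⟩ := hrw.exists_parts
    obtain ⟨f, hf⟩ := ih
    obtain ⟨f', fq, h₁⟩ := f.exists_split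
    obtain ⟨fp, fr, h₂⟩ := f'.exists_split
    obtain ⟨e, he⟩ := exists_append fp (.node r hr fr .nil)
    obtain ⟨e', he'⟩ := exists_append e fq
    exact ⟨e', by simp [he', he, ← hf, h₁, h₂, yield]⟩

lemma mem_language_iff_nonempty_parseTree {w : List T} :
    w ∈ g.language ↔ Nonempty (g.ParseTree g.initial w) := by
  rw [mem_language_iff, derives_iff_exists_parseForest]
  exact ⟨fun ⟨f, hf⟩ ↦ ⟨⟨f, hf⟩⟩, fun ⟨⟨f, hf⟩⟩ ↦ ⟨f, hf⟩⟩

/-- An unambiguous grammar, as a GF(2)-grammar. -/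
def IsUnambiguous.toGF2Grammar (h : g.IsUnambiguous) : GF2Grammar T where
  toCFG := g
  finite_parseTree w := have := h w; inferInstance

/-- A type with at most one element has odd cardinality exactly when it is nonempty. -/
lemma IsUnambiguous.language_toGF2Grammar (h : g.IsUnambiguous) :
    h.toGF2Grammar.language = g.language := by
  ext w
  have := h w
  rw [mem_language_iff_nonempty_parseTree]
  change Odd (Nat.card (g.ParseTree g.initial w)) ↔ _
  rcases isEmpty_or_nonempty (g.ParseTree g.initial w) with h' | h'
  · simpa using h'
  · simpa [Nat.card_of_subsingleton h'.some] using h'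

end ContextFreeGrammar

/-! ### An ordinary grammar for the language. -/

namespace ContextFreeGrammar

variable {T : Type*} {g : ContextFreeGrammar T}

open ParseForest

lemma derives_of_rule {r : ContextFreeRule T g.NT} (hr : r ∈ g.rules) {w : List (Symbol T g.NT)}
    (h : g.Derives r.output w) : g.Derives [.nonterminal r.input] w :=
  (Produces.single ⟨r, hr, ContextFreeRule.Rewrites.input_output⟩).trans h

lemma Derives.append {u u' v v' : List (Symbol T g.NT)} (hu : g.Derives u u')
    (hv : g.Derives v v') : g.Derives (u ++ v) (u' ++ v') :=
  (hu.append_right v).trans (hv.append_left u')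

/-- The words that a string of symbols describes when each nonterminal is read as a language. -/
def InterpMem {N : Type*} (I : N → List T → Prop) : List (Symbol T N) → List T → Prop
  | [], w => w = []
  | .terminal x :: s, w => ∃ v, InterpMem I s v ∧ w = x :: v
  | .nonterminal A :: s, w => ∃ u v, I A u ∧ InterpMem I s v ∧ w = u ++ v

/-- Soundness principle: languages closed under the rules contain everything that the grammar
generates. -/
lemma ParseForest.interpMem_yield {I : g.NT → List T → Prop}
    (hI : ∀ r ∈ g.rules, ∀ w, InterpMem I r.output w → I r.input w) {s : List (Symbol T g.NT)}
    (f : g.ParseForest s) : InterpMem I s f.yield := by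
  induction f with
  | nil => rfl
  | leaf x f ih => exact ⟨_, ih, rfl⟩
  | node r hr ch f ihc ihf => exact ⟨_, _, hI r hr _ ihc, ihf, rfl⟩

end ContextFreeGrammar

/-- Nonterminals of a grammar for `neOrNeLanguage`: the initial symbol, iterated letters, and
balanced words `xⁿ yⁿ`. -/
inductive NeOrNeNT
  | start | letter (i : Fin 3) | balanced (i : Bool)

section
variable {T : Type*} (a b c : T)

/-- The rules of a grammar for `neOrNeLanguage`. -/
def neOrNeRules : List (ContextFreeRule T NeOrNeNT) :=
  let A := Symbol.nonterminal (NeOrNeNT.letter 0)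
  let B := Symbol.nonterminal (NeOrNeNT.letter 1)
  let C := Symbol.nonterminal (NeOrNeNT.letter 2)
  let P := Symbol.nonterminal (NeOrNeNT.balanced false)
  let Q := Symbol.nonterminal (NeOrNeNT.balanced true)
  [⟨.start, [.terminal a, A, P, C]⟩, ⟨.start, [P, .terminal b, B, C]⟩,
    ⟨.start, [A, .terminal b, B, Q]⟩, ⟨.start, [A, Q, .terminal c, C]⟩,
    ⟨.letter 0, []⟩, ⟨.letter 0, [.terminal a, A]⟩,
    ⟨.letter 1, []⟩, ⟨.letter 1, [.terminal b, B]⟩,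
    ⟨.letter 2, []⟩, ⟨.letter 2, [.terminal c, C]⟩,
    ⟨.balanced false, []⟩, ⟨.balanced false, [.terminal a, P, .terminal b]⟩,
    ⟨.balanced true, []⟩, ⟨.balanced true, [.terminal b, Q, .terminal c]⟩]

open Classical in
/-- A grammar for `neOrNeLanguage`. -/
noncomputable def neOrNeGrammar : ContextFreeGrammar T where
  NT := NeOrNeNT
  initial := .start
  rules := (neOrNeRules a b c).toFinset

lemma mem_rules_neOrNeGrammar {r : ContextFreeRule T NeOrNeNT} :
    r ∈ (neOrNeGrammar a b c).rules ↔ r ∈ neOrNeRules a b c := by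
  classical exact List.mem_toFinset

/-- The languages described by the nonterminals of `neOrNeGrammar`. -/
def neOrNeInterp : NeOrNeNT → List T → Prop
  | .start, w => w ∈ neOrNeLanguage a b c
  | .letter i, w => ∃ n, w = List.replicate n (![a, b, c] i)
  | .balanced false, w => ∃ n, w = List.replicate n a ++ List.replicate n b
  | .balanced true, w => ∃ n, w = List.replicate n b ++ List.replicate n c

lemma neOrNeInterp_of_interpMem {r : ContextFreeRule T NeOrNeNT} (hr : r ∈ neOrNeRules a b c)
    {w : List T} (hw : ContextFreeGrammar.InterpMem (neOrNeInterp a b c) r.output w) :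
    neOrNeInterp a b c r.input w := by
  have ra (x : T) (n : ℕ) (l : List T) :
      List.replicate n x ++ x :: l = List.replicate (n + 1) x ++ l := by
    simp [List.replicate_succ']
  have rr (x : T) (n m : ℕ) (l : List T) :
      List.replicate n x ++ (List.replicate m x ++ l) = List.replicate (n + m) x ++ l := by
    rw [← List.append_assoc, List.replicate_append_replicate]
  simp only [neOrNeRules, List.mem_cons, List.not_mem_nil, or_false] at hr
  rcases hr with rfl | rfl | rfl | rfl | rfl | rfl | rfl | rfl | rfl | rfl | rfl | rfl | rfl | rfl
  all_goals simp only [ContextFreeGrammar.InterpMem, neOrNeInterp] at hw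
  · obtain ⟨_, ⟨_, _, ⟨n, rfl⟩, ⟨_, _, ⟨m, rfl⟩, ⟨_, _, ⟨l, rfl⟩, rfl, rfl⟩, rfl⟩, rfl⟩, rfl⟩ := hw
    exact ⟨n + m + 1, m, l, by omega, by simp [rr, List.replicate_succ]⟩
  · obtain ⟨_, _, ⟨n, rfl⟩, ⟨_, ⟨_, _, ⟨m, rfl⟩, ⟨_, _, ⟨l, rfl⟩, rfl, rfl⟩, rfl⟩, rfl⟩, rfl⟩ := hw
    exact ⟨n, n + 1 + m, l, by omega, by simp [rr, ra]⟩
  · obtain ⟨_, _, ⟨n, rfl⟩, ⟨_, ⟨_, _, ⟨m, rfl⟩, ⟨_, _, ⟨l, rfl⟩, rfl, rfl⟩, rfl⟩, rfl⟩, rfl⟩ := hw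
    exact ⟨n, m + l + 1, l, by omega, by simp [rr, List.replicate_succ]⟩
  · obtain ⟨_, _, ⟨n, rfl⟩, ⟨_, _, ⟨m, rfl⟩, ⟨_, ⟨_, _, ⟨l, rfl⟩, rfl, rfl⟩, rfl⟩, rfl⟩, rfl⟩ := hw
    exact ⟨n, m, m + 1 + l, by omega, by simp [ra]⟩
  -- This disposes of the five rules with empty right-hand side.
  all_goals first | exact ⟨0, hw⟩ | skip
  · obtain ⟨_, ⟨_, _, ⟨n, rfl⟩, rfl, rfl⟩, rfl⟩ := hw
    exact ⟨n + 1, by simp [List.replicate_succ]⟩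
  · obtain ⟨_, ⟨_, _, ⟨n, rfl⟩, rfl, rfl⟩, rfl⟩ := hw
    exact ⟨n + 1, by simp [List.replicate_succ]⟩
  · obtain ⟨_, ⟨_, _, ⟨n, rfl⟩, rfl, rfl⟩, rfl⟩ := hw
    exact ⟨n + 1, by simp [List.replicate_succ]⟩
  · obtain ⟨_, ⟨_, _, ⟨n, rfl⟩, ⟨_, rfl, rfl⟩, rfl⟩, rfl⟩ := hw
    exact ⟨n + 1, by rw [List.replicate_succ, List.replicate_succ']; simp⟩
  · obtain ⟨_, ⟨_, _, ⟨n, rfl⟩, ⟨_, rfl, rfl⟩, rfl⟩, rfl⟩ := hw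
    exact ⟨n + 1, by rw [List.replicate_succ, List.replicate_succ']; simp⟩

lemma isContextFree_neOrNeLanguage : (neOrNeLanguage a b c).IsContextFree := by
  classical
  refine ⟨neOrNeGrammar a b c, le_antisymm (fun w hw ↦ ?_) ?_⟩
  · obtain ⟨f, rfl⟩ := ContextFreeGrammar.derives_iff_exists_parseForest.1
      ((ContextFreeGrammar.mem_language_iff _ _).1 hw)
    obtain ⟨u, v, hu, rfl, h⟩ := f.interpMem_yield (I := neOrNeInterp a b c) fun r hr _ ↦
      neOrNeInterp_of_interpMem a b c ((mem_rules_neOrNeGrammar a b c).1 hr)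
    rw [h, List.append_nil]
    exact hu
  set g := neOrNeGrammar a b c
  -- Rules are addressed by their position `i` in the list, so that membership is checked by `rfl`.
  have rule (A : NeOrNeNT) (o : List (Symbol T NeOrNeNT)) (w : List T)
      {i : ℕ}
      (hr : (neOrNeRules a b c)[i]? = some ⟨A, o⟩) (h : g.Derives o (w.map .terminal)) :
      g.Derives [.nonterminal A] (w.map .terminal) :=
    ContextFreeGrammar.derives_of_rule
      ((mem_rules_neOrNeGrammar a b c).2 (List.mem_of_getElem? hr)) h
  have term (x : T) (o : List (Symbol T NeOrNeNT)) (w : List T)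
      (h : g.Derives o (w.map .terminal)) :
      g.Derives (.terminal x :: o) ((x :: w).map .terminal) := h.append_left [.terminal x]
  have cons (A : NeOrNeNT) (o : List (Symbol T NeOrNeNT)) (u w : List T)
      (h' : g.Derives [.nonterminal A] (u.map .terminal)) (h : g.Derives o (w.map .terminal)) :
      g.Derives (.nonterminal A :: o) ((u ++ w).map .terminal) := by
    rw [List.map_append]
    exact h'.append h
  have nil : g.Derives [] (([] : List T).map .terminal) := ContextFreeGrammar.Derives.refl _
  have hA (n : ℕ) : g.Derives [.nonterminal (.letter 0)] ((List.replicate n a).map .terminal) := by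
    induction n with
    | zero => exact rule _ [] _ (i := 4) rfl nil
    | succ n ih => exact rule _ _ _ (i := 5) rfl (term _ _ _ ih)
  have hB (n : ℕ) : g.Derives [.nonterminal (.letter 1)] ((List.replicate n b).map .terminal) := by
    induction n with
    | zero => exact rule _ [] _ (i := 6) rfl nil
    | succ n ih => exact rule _ _ _ (i := 7) rfl (term _ _ _ ih)
  have hC (n : ℕ) : g.Derives [.nonterminal (.letter 2)] ((List.replicate n c).map .terminal) := by
    induction n with
    | zero => exact rule _ [] _ (i := 8) rfl nil
    | succ n ih => exact rule _ _ _ (i := 9) rfl (term _ _ _ ih)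
  have hP (n : ℕ) : g.Derives [.nonterminal (.balanced false)]
      ((List.replicate n a ++ List.replicate n b).map .terminal) := by
    induction n with
    | zero => exact rule _ [] _ (i := 10) rfl nil
    | succ n ih =>
      rw [List.replicate_succ, List.replicate_succ', List.cons_append, ← List.append_assoc]
      exact rule _ [.terminal a, .nonterminal (.balanced false), .terminal b] _
        (i := 11) rfl (term _ _ _ (cons _ _ _ _ ih (term _ _ _ nil)))
  have hQ (n : ℕ) : g.Derives [.nonterminal (.balanced true)]
      ((List.replicate n b ++ List.replicate n c).map .terminal) := by
    induction n with
    | zero => exact rule _ [] _ (i := 12) rfl nil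
    | succ n ih =>
      rw [List.replicate_succ, List.replicate_succ', List.cons_append, ← List.append_assoc]
      exact rule _ [.terminal b, .nonterminal (.balanced true), .terminal c] _
        (i := 13) rfl (term _ _ _ (cons _ _ _ _ ih (term _ _ _ nil)))
  rintro _ ⟨n, m, l, h, rfl⟩
  refine (ContextFreeGrammar.mem_language_iff _ _).2 ?_
  change g.Derives [.nonterminal .start] _
  -- The four cases correspond to the four rules for `start`.
  have h' : m < n ∨ n < m ∨ l < m ∨ m < l := by omega
  rcases h' with h | h | h | h
  · obtain ⟨k, rfl⟩ := Nat.exists_eq_add_of_lt h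
    convert rule .start _ _ (i := 0) rfl
      (term a _ _ (cons _ _ _ _ (hA k) (cons _ _ _ _ (hP m) (hC l)))) using 2
    simp only [show m + k + 1 = k + m + 1 by omega, List.replicate_succ,
      ← List.replicate_append_replicate, List.cons_append, List.append_assoc]
  · obtain ⟨k, rfl⟩ := Nat.exists_eq_add_of_lt h
    convert rule .start _ _ (i := 1) rfl
      (cons _ _ _ _ (hP n) (term b _ _ (cons _ _ _ _ (hB k) (hC l)))) using 2
    rw [show n + k + 1 = n + (k + 1) by omega, ← List.replicate_append_replicate,
      List.replicate_succ]
    simp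
  · obtain ⟨k, rfl⟩ := Nat.exists_eq_add_of_lt h
    convert rule .start _ _ (i := 2) rfl
      (cons _ _ _ _ (hA n) (term b _ _ (cons _ _ _ _ (hB k) (hQ l)))) using 2
    simp only [show l + k + 1 = k + l + 1 by omega, List.replicate_succ,
      ← List.replicate_append_replicate, List.cons_append, List.append_assoc]
  · obtain ⟨k, rfl⟩ := Nat.exists_eq_add_of_lt h
    convert rule .start _ _ (i := 3) rfl
      (cons _ _ _ _ (hA n) (cons _ _ _ _ (hQ m) (term c _ _ (hC k)))) using 2
    rw [show m + k + 1 = m + (k + 1) by omega, ← List.replicate_append_replicate,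
      List.replicate_succ]
    simp
end

/-! ### Power series counting the forests of sorted words. -/

section Counting

open Finset

section Run
variable {T : Type*} (e : Fin 3 → T)

/-- `SortedRun e p w q d` says that `w` is a product of letters `e r` with nondecreasing indices
`r ≥ p`, that `q` is the last index (`p` if `w` is empty), and that `d` counts the letters. -/
def SortedRun : Fin 3 → List T → Fin 3 → (Fin 3 →₀ ℕ) → Prop
  | p, [], q, d => p = q ∧ d = 0
  | p, x :: w, q, d => ∃ r d', p ≤ r ∧ x = e r ∧ SortedRun r w q d' ∧ d = Finsupp.single r 1 + d'

variable {e}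

lemma SortedRun.le {p q : Fin 3} {w : List T} {d : Fin 3 →₀ ℕ} (h : SortedRun e p w q d) :
    p ≤ q := by
  induction w generalizing p d with
  | nil => exact h.1.le
  | cons x w ih =>
    obtain ⟨r, d', hpr, -, hr, -⟩ := h
    exact hpr.trans (ih hr)

lemma sortedRun_append {p q : Fin 3} {u v : List T} {d : Fin 3 →₀ ℕ} :
    SortedRun e p (u ++ v) q d ↔
      ∃ r d₁ d₂, SortedRun e p u r d₁ ∧ SortedRun e r v q d₂ ∧ d₁ + d₂ = d := by
  induction u generalizing p d with
  | nil =>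
    constructor
    · exact fun h ↦ ⟨p, 0, d, ⟨rfl, rfl⟩, h, zero_add _⟩
    · rintro ⟨r, d₁, d₂, ⟨rfl, rfl⟩, h, rfl⟩
      simpa using h
  | cons x u ih =>
    constructor
    · rintro ⟨r, d', hpr, hx, h, rfl⟩
      obtain ⟨s, d₁, d₂, h₁, h₂, rfl⟩ := ih.1 h
      exact ⟨s, _, d₂, ⟨r, d₁, hpr, hx, h₁, rfl⟩, h₂, add_assoc _ _ _⟩
    · rintro ⟨s, _, d₂, ⟨r, d₁, hpr, hx, h₁, rfl⟩, h₂, rfl⟩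
      exact ⟨r, d₁ + d₂, hpr, hx, ih.2 ⟨s, d₁, d₂, h₁, h₂, rfl⟩, add_assoc _ _ _⟩

/-- The runs are those of a deterministic automaton whose state is the last index read. This is what
makes the splitting of forests below bijective. -/
lemma SortedRun.unique (he : Function.Injective e) {p q q' : Fin 3} {w : List T}
    {d d' : Fin 3 →₀ ℕ} (h : SortedRun e p w q d) (h' : SortedRun e p w q' d') :
    q = q' ∧ d = d' := by
  induction w generalizing p d d' with
  | nil => exact ⟨h.1.symm.trans h'.1, h.2.trans h'.2.symm⟩
  | cons x w ih =>
    obtain ⟨r, d₁, -, rfl, h₁, rfl⟩ := h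
    obtain ⟨r', d₂, -, hr, h₂, rfl⟩ := h'
    obtain rfl := he hr
    obtain ⟨rfl, rfl⟩ := ih h₁ h₂
    exact ⟨rfl, rfl⟩

/-- The sorted word with given numbers of letters. -/
def sortedWord (e : Fin 3 → T) (d : Fin 3 →₀ ℕ) : List T :=
  List.replicate (d 0) (e 0) ++ List.replicate (d 1) (e 1) ++ List.replicate (d 2) (e 2)

/-- The vanishing below `p` is carried through the induction so that a letter put in front of the
sorted word keeps it sorted. -/
lemma SortedRun.eq_zero_and_eq_sortedWord {p q : Fin 3} {w : List T} {d : Fin 3 →₀ ℕ}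
    (h : SortedRun e p w q d) : (∀ j < p, d j = 0) ∧ w = sortedWord e d := by
  induction w generalizing p d with
  | nil => obtain ⟨rfl, rfl⟩ := h; simp [sortedWord]
  | cons x w ih =>
    obtain ⟨r, d', hpr, rfl, hr, rfl⟩ := h
    obtain ⟨h0, rfl⟩ := ih hr
    refine ⟨fun j hj ↦ ?_, ?_⟩
    · simp [h0 j (hj.trans_le hpr), (hj.trans_le hpr).ne']
    · fin_cases r
      · simp [sortedWord, add_comm 1, List.replicate_succ]
      · have := h0 0 (by decide)
        simp [sortedWord, add_comm 1, List.replicate_succ, this]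
      · have h₁ := h0 0 (by decide)
        have h₂ := h0 1 (by decide)
        simp [sortedWord, add_comm 1, List.replicate_succ, h₁, h₂]

lemma exists_sortedRun_replicate {p q : Fin 3} (hpq : p ≤ q) (n : ℕ) :
    ∃ r ≤ q, SortedRun e p (List.replicate n (e q)) r (Finsupp.single q n) := by
  induction n generalizing p with
  | zero => exact ⟨p, hpq, rfl, by simp⟩
  | succ n ih =>
    obtain ⟨r, hr, h⟩ := ih le_rfl
    exact ⟨r, hr, q, _, hpq, rfl, h, by rw [add_comm, Finsupp.single_add]⟩

lemma exists_sortedRun_sortedWord (e : Fin 3 → T) (d : Fin 3 →₀ ℕ) :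
    ∃ q, SortedRun e 0 (sortedWord e d) q d := by
  obtain ⟨r₀, h₀, h⟩ := exists_sortedRun_replicate (e := e) (le_refl (0 : Fin 3)) (d 0)
  obtain ⟨r₁, h₁, h'⟩ :=
    exists_sortedRun_replicate (e := e) (h₀.trans (by decide : (0 : Fin 3) ≤ 1)) (d 1)
  obtain ⟨r₂, h₂, h''⟩ :=
    exists_sortedRun_replicate (e := e) (h₁.trans (by decide : (1 : Fin 3) ≤ 2)) (d 2)
  refine ⟨r₂, sortedRun_append.2 ⟨_, _, _, sortedRun_append.2 ⟨_, _, _, h, h', rfl⟩, h'', ?_⟩⟩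
  ext j
  fin_cases j <;> simp

lemma sortedRun_singleton (he : Function.Injective e) {p q r : Fin 3} {d : Fin 3 →₀ ℕ} :
    SortedRun e p [e r] q d ↔ p ≤ q ∧ r = q ∧ d = Finsupp.single q 1 := by
  constructor
  · rintro ⟨r', d', h, hr, ⟨rfl, rfl⟩, rfl⟩
    exact ⟨h, he hr, by simp⟩
  · rintro ⟨h, rfl, rfl⟩
    exact ⟨r, 0, h, rfl, ⟨rfl, rfl⟩, by simp⟩

end Run

namespace ContextFreeGrammar

variable {T : Type*} (g : ContextFreeGrammar T)

open ParseForest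

/-- A string of symbols that has a sequence of parse trees, and whose sequences of parse trees embed
into the parse trees as the initial symbol, up to a fixed context of the word. -/
structure IsUseful (s : List (Symbol T g.NT)) : Prop where
  nonempty : Nonempty (g.ParseForest s)
  exists_embedding : ∃ (u v : List T)
    (φ : g.ParseForest s → g.ParseForest [.nonterminal g.initial]),
    Function.Injective φ ∧ ∀ f, (φ f).yield = u ++ f.yield ++ v

variable {g}

lemma IsUseful.head {X : Symbol T g.NT} {s : List (Symbol T g.NT)} (h : g.IsUseful (X :: s)) :
    g.IsUseful [X] := by
  obtain ⟨⟨f₀⟩, u, v, φ, hφ, hy⟩ := h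
  refine ⟨⟨f₀.head⟩, u, f₀.tail.yield ++ v, fun t ↦ φ (cons t f₀.tail), fun t t' htt' ↦ ?_, ?_⟩
  · simpa using congrArg ParseForest.head (hφ htt')
  · simp [hy]

lemma IsUseful.tail {X : Symbol T g.NT} {s : List (Symbol T g.NT)} (h : g.IsUseful (X :: s)) :
    g.IsUseful s := by
  obtain ⟨⟨f₀⟩, u, v, φ, hφ, hy⟩ := h
  refine ⟨⟨f₀.tail⟩, u ++ f₀.head.yield, v, fun t ↦ φ (cons f₀.head t), fun t t' htt' ↦ ?_, ?_⟩
  · simpa using congrArg ParseForest.tail (hφ htt')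
  · simp [hy]

/-- Nonemptiness is a separate hypothesis because a useful nonterminal may also have rules that
yield no tree. -/
lemma IsUseful.output {r : ContextFreeRule T g.NT} (h : g.IsUseful [.nonterminal r.input])
    (hr : r ∈ g.rules) (hne : Nonempty (g.ParseForest r.output)) : g.IsUseful r.output := by
  obtain ⟨-, u, v, φ, hφ, hy⟩ := h
  refine ⟨hne, u, v, fun t ↦ φ (.node r hr t .nil), fun t t' htt' ↦ ?_, ?_⟩
  · have := hφ htt'
    simpa using this
  · simp [hy, yield]

/-- Every word has finitely many parse trees as the initial symbol. -/
def IsFinitelyAmbiguous (g : ContextFreeGrammar T) : Prop :=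
  ∀ w : List T, Finite (g.ParseTree g.initial w)

/-- Finiteness is assumed only at the initial symbol; the embedding transfers it from the trees of
`u ++ w ++ v`. -/
lemma IsUseful.finite (hg : g.IsFinitelyAmbiguous) {s : List (Symbol T g.NT)} (h : g.IsUseful s)
    (w : List T) : Finite {f : g.ParseForest s // f.yield = w} := by
  obtain ⟨-, u, v, φ, hφ, hy⟩ := h
  have := hg (u ++ w ++ v)
  refine Finite.of_injective (β := g.ParseTree g.initial (u ++ w ++ v))
    (fun f ↦ ⟨φ f.1, by rw [hy, f.2]⟩) fun f f' hff' ↦ ?_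
  exact Subtype.ext (hφ (congrArg Subtype.val hff'))

/-- The nonterminals that are useful. -/
abbrev Useful (g : ContextFreeGrammar T) : Type := {A : g.NT // g.IsUseful [.nonterminal A]}

/-- A nonterminal with a parse tree is the input of one of the finitely many rules, even if `g.NT`
is infinite. -/
instance : Finite g.Useful := by
  classical
  refine Set.Finite.to_subtype (s := {A | g.IsUseful [.nonterminal A]})
    (((g.rules.image (·.input)).finite_toSet).subset fun A hA ↦ ?_)
  obtain ⟨f⟩ := hA.nonempty
  obtain ⟨⟨r, hr, rfl⟩, -⟩ := nodeEquiv A f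
  simpa using ⟨r, hr, rfl⟩

/-- The forests of a string of symbols that contribute to a coefficient of its series. -/
abbrev SortedForest (e : Fin 3 → T) (p q : Fin 3) (s : List (Symbol T g.NT)) (d : Fin 3 →₀ ℕ) :=
  {f : g.ParseForest s // SortedRun e p f.yield q d}

lemma IsUseful.finite_sortedForest (hg : g.IsFinitelyAmbiguous) {s : List (Symbol T g.NT)}
    (h : g.IsUseful s) (e : Fin 3 → T) (p q : Fin 3) (d : Fin 3 →₀ ℕ) :
    Finite (SortedForest e p q s d) := by
  have := h.finite hg (sortedWord e d)
  exact Finite.of_injective (fun f : SortedForest e p q s d ↦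
    (⟨f.1, f.2.eq_zero_and_eq_sortedWord.2⟩ : {f : g.ParseForest s // f.yield = sortedWord e d}))
    fun f f' h ↦ Subtype.ext (congrArg (fun x ↦ x.1) h)

/-- The series that counts, modulo two, the forests of a string of symbols whose yields are sorted
words from one index to another, by the numbers of their letters. -/
noncomputable def series (e : Fin 3 → T) (p q : Fin 3) (s : List (Symbol T g.NT)) :
    MvPowerSeries (Fin 3) (ZMod 2) :=
  fun d ↦ (Nat.card (SortedForest e p q s d) : ZMod 2)

variable {e : Fin 3 → T} {p q : Fin 3}

lemma coeff_series (s : List (Symbol T g.NT)) (d : Fin 3 →₀ ℕ) :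
    MvPowerSeries.coeff d (series e p q s) = (Nat.card (SortedForest e p q s d) : ZMod 2) := rfl

lemma series_eq_zero (h : q < p) (s : List (Symbol T g.NT)) : series e p q s = 0 := by
  ext d
  have : IsEmpty (SortedForest e p q s d) := ⟨fun f ↦ h.not_ge f.2.le⟩
  simp [coeff_series]

lemma series_nil : series e p q ([] : List (Symbol T g.NT)) = if p = q then 1 else 0 := by
  ext d
  rw [coeff_series]
  by_cases h : p = q ∧ d = 0
  · have : Unique (SortedForest e p q ([] : List (Symbol T g.NT)) d) :=
      ⟨⟨⟨.nil, h⟩⟩, fun f ↦ Subtype.ext f.1.eq_nil⟩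
    rw [Nat.card_unique, if_pos h.1, h.2]
    simp
  · have : IsEmpty (SortedForest e p q ([] : List (Symbol T g.NT)) d) :=
      ⟨fun ⟨f, hf⟩ ↦ h (by cases f; exact hf)⟩
    split_ifs with hpq
    · have : d ≠ 0 := fun hd ↦ h ⟨hpq, hd⟩
      simp [MvPowerSeries.coeff_one, this]
    · simp

lemma series_terminal (he : Function.Injective e) (x : T) :
    series e p q ([.terminal x] : List (Symbol T g.NT)) = 0 ∨
      series e p q ([.terminal x] : List (Symbol T g.NT)) = MvPowerSeries.X q := by
  by_cases h : p ≤ q ∧ x = e q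
  · obtain ⟨hpq, rfl⟩ := h
    right
    ext d
    rw [coeff_series, MvPowerSeries.coeff_X]
    split_ifs with hd
    · have : Unique (SortedForest e p q ([.terminal (e q)] : List (Symbol T g.NT)) d) :=
        ⟨⟨⟨.leaf _ .nil, (sortedRun_singleton he).2 ⟨hpq, rfl, hd⟩⟩⟩,
          fun f ↦ Subtype.ext f.1.eq_leaf⟩
      simp
    · have : IsEmpty (SortedForest e p q ([.terminal (e q)] : List (Symbol T g.NT)) d) :=
        ⟨fun ⟨f, hf⟩ ↦ hd (by rw [f.eq_leaf] at hf; exact ((sortedRun_singleton he).1 hf).2.2)⟩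
      simp
  · left
    ext d
    have : IsEmpty (SortedForest e p q ([.terminal x] : List (Symbol T g.NT)) d) := by
      refine ⟨fun ⟨f, hf⟩ ↦ h ?_⟩
      rw [f.eq_leaf] at hf
      obtain ⟨r, d', hpr, hx, ⟨rfl, -⟩, -⟩ := hf
      exact ⟨hpr, hx⟩
    simp [coeff_series]

/-- Splitting a forest into its first tree and the others. -/
noncomputable def sortedForestConsEquiv (he : Function.Injective e) (X : Symbol T g.NT)
    (s : List (Symbol T g.NT)) (d : Fin 3 →₀ ℕ) :
    SortedForest e p q (X :: s) d ≃
      Σ i : Fin 3 × antidiagonal d,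
        SortedForest e p i.1 [X] i.2.1.1 × SortedForest e i.1 q s i.2.1.2 := by
  symm
  refine Equiv.ofBijective (fun x ↦ ⟨cons x.2.1.1 x.2.2.1, ?_⟩) ⟨?_, ?_⟩
  · rw [yield_cons]
    exact sortedRun_append.2 ⟨_, _, _, x.2.1.2, x.2.2.2, mem_antidiagonal.1 x.1.2.2⟩
  · rintro ⟨⟨r, ⟨⟨d₁, d₂⟩, hd⟩⟩, ⟨t, ht⟩, ⟨f, hf⟩⟩ ⟨⟨r', ⟨⟨d₁', d₂'⟩, hd'⟩⟩, ⟨t', ht'⟩, ⟨f', hf'⟩⟩ h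
    have h' := congrArg Subtype.val h
    obtain rfl : t = t' := by simpa using congrArg ParseForest.head h'
    obtain rfl : f = f' := by simpa using congrArg ParseForest.tail h'
    obtain ⟨rfl, h₁⟩ := ht.unique he ht'
    have h₂ := (hf.unique he hf').2
    dsimp only at h₁ h₂
    subst h₁ h₂
    rfl
  · rintro ⟨f, hf⟩
    rw [yield_eq_head_append_tail] at hf
    obtain ⟨r, d₁, d₂, h₁, h₂, hd⟩ := sortedRun_append.1 hf
    exact ⟨⟨⟨r, ⟨⟨d₁, d₂⟩, mem_antidiagonal.2 hd⟩⟩, ⟨f.head, h₁⟩, ⟨f.tail, h₂⟩⟩,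
      Subtype.ext (cons_head_tail f)⟩

lemma series_cons (hg : g.IsFinitelyAmbiguous) (he : Function.Injective e) {X : Symbol T g.NT}
    {s : List (Symbol T g.NT)} (h : g.IsUseful (X :: s)) :
    series e p q (X :: s) = ∑ r, series e p r [X] * series e r q s := by
  ext d
  -- `Nat.card` is zero on infinite types, so its sum formula over the splitting needs this
  -- finiteness.
  have h₁ := fun r d ↦ h.head.finite_sortedForest hg e p r d
  have h₂ := fun r d ↦ h.tail.finite_sortedForest hg e r q d
  rw [coeff_series, Nat.card_congr (sortedForestConsEquiv he X s d), Nat.card_sigma, map_sum,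
    Fintype.sum_prod_type, Nat.cast_sum]
  refine Finset.sum_congr rfl fun r _ ↦ ?_
  rw [MvPowerSeries.coeff_mul, Nat.cast_sum, ← Finset.sum_coe_sort (antidiagonal d)]
  simp [Nat.card_prod, coeff_series]

open Classical in
/-- The rules for a nonterminal with right-hand sides that have parse forests. -/
noncomputable def productiveRules (A : g.NT) : Finset (ContextFreeRule T g.NT) :=
  g.rules.filter fun r ↦ r.input = A ∧ Nonempty (g.ParseForest r.output)

lemma mem_productiveRules {A : g.NT} {r : ContextFreeRule T g.NT} :
    r ∈ productiveRules A ↔ r ∈ g.rules ∧ r.input = A ∧ Nonempty (g.ParseForest r.output) := by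
  simp [productiveRules]

lemma IsUseful.of_mem_productiveRules {A : g.NT} (h : g.IsUseful [.nonterminal A])
    {r : ContextFreeRule T g.NT} (hr : r ∈ productiveRules A) : g.IsUseful r.output := by
  obtain ⟨hr', rfl, hne⟩ := mem_productiveRules.1 hr
  exact h.output hr' hne

/-- Splitting a tree into the rule at its root and its subtrees. -/
noncomputable def sortedForestNodeEquiv (A : g.NT) (d : Fin 3 →₀ ℕ) :
    SortedForest e p q [.nonterminal A] d ≃
      Σ r : productiveRules A, SortedForest e p q r.1.output d := by
  symm
  refine Equiv.ofBijective (fun x ↦ ⟨(nodeEquiv A).symm ⟨⟨x.1.1,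
    (mem_productiveRules.1 x.1.2).1, (mem_productiveRules.1 x.1.2).2.1⟩, x.2.1⟩, ?_⟩) ⟨?_, ?_⟩
  · simpa using x.2.2
  · rintro ⟨⟨r, hr⟩, f, hf⟩ ⟨⟨r', hr'⟩, f', hf'⟩ h
    have h' := (nodeEquiv A).symm.injective (congrArg Subtype.val h)
    simp only [Sigma.mk.injEq, Subtype.mk.injEq] at h'
    obtain ⟨rfl, h'⟩ := h'
    obtain rfl := eq_of_heq h'
    rfl
  · rintro ⟨f, hf⟩
    obtain ⟨⟨⟨r, hr, hA⟩, f⟩, rfl⟩ := (nodeEquiv A).symm.surjective f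
    refine ⟨⟨⟨r, mem_productiveRules.2 ⟨hr, hA, ⟨f⟩⟩⟩, f, by simpa using hf⟩, rfl⟩

/-- Unproductive rules contribute no trees; dropping them leaves only useful right-hand sides. -/
lemma series_nonterminal (hg : g.IsFinitelyAmbiguous) {A : g.NT}
    (h : g.IsUseful [.nonterminal A]) :
    series e p q [.nonterminal A] = ∑ r ∈ productiveRules A, series e p q r.output := by
  ext d
  have h₁ := fun r : productiveRules A ↦
    (h.of_mem_productiveRules r.2).finite_sortedForest hg e p q d
  rw [coeff_series, Nat.card_congr (sortedForestNodeEquiv A d), Nat.card_sigma, map_sum,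
    Nat.cast_sum, ← Finset.sum_coe_sort (productiveRules A)]
  simp [coeff_series]

end ContextFreeGrammar

end Counting

/-! ### The linear system of a grammar and its nondegeneracy. -/

namespace ContextFreeGrammar

variable {T : Type*} {g : ContextFreeGrammar T}

open ParseForest

noncomputable instance : Fintype g.Useful := Fintype.ofFinite _

noncomputable instance : DecidableEq g.Useful := Classical.decEq _

open Classical in
/-- The coefficients in the expansion of an additive function `G` of strings of symbols with
`G (X :: s) = f [X] • G s + h s • G [X]` through its values at the useful nonterminals. -/
noncomputable def leibnizCoeff {R : Type*} [CommRing R] (f h : List (Symbol T g.NT) → R) :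
    List (Symbol T g.NT) → g.Useful → R
  | [], _ => 0
  | X :: s, B => f [X] * leibnizCoeff f h s B + if X = .nonterminal B.1 then h s else 0

/-- The matrix of the linear system for the values at the useful nonterminals of an additive
function as in `leibnizCoeff`. -/
noncomputable def leibnizMatrix {R : Type*} [CommRing R] (f h : List (Symbol T g.NT) → R) :
    Matrix g.Useful g.Useful R :=
  fun A B ↦ ∑ r ∈ productiveRules A.1, leibnizCoeff f h r.output B

lemma map_leibnizCoeff {R S : Type*} [CommRing R] [CommRing S] (ι : R →+* S)
    {f h : List (Symbol T g.NT) → R} {f' h' : List (Symbol T g.NT) → S}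
    (hf : ∀ s, g.IsUseful s → ι (f s) = f' s) (hh : ∀ s, g.IsUseful s → ι (h s) = h' s)
    {s : List (Symbol T g.NT)} (hs : g.IsUseful s) (B : g.Useful) :
    ι (leibnizCoeff f h s B) = leibnizCoeff f' h' s B := by
  induction s with
  | nil => simp [leibnizCoeff]
  | cons X s ih =>
    simp [leibnizCoeff, hf _ hs.head, hh _ hs.tail, ih hs.tail, apply_ite ι]

lemma map_leibnizMatrix {R S : Type*} [CommRing R] [CommRing S] (ι : R →+* S)
    {f h : List (Symbol T g.NT) → R} {f' h' : List (Symbol T g.NT) → S}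
    (hf : ∀ s, g.IsUseful s → ι (f s) = f' s) (hh : ∀ s, g.IsUseful s → ι (h s) = h' s) :
    ι.mapMatrix (leibnizMatrix f h) = leibnizMatrix f' h' := by
  ext A B
  simp only [RingHom.mapMatrix_apply, Matrix.map_apply, leibnizMatrix, map_sum]
  exact Finset.sum_congr rfl fun r hr ↦
    map_leibnizCoeff ι hf hh (A.2.of_mem_productiveRules hr) B

lemma exists_yield_eq_nil {e : Fin 3 → T} {p : Fin 3} {s : List (Symbol T g.NT)}
    (h : MvPowerSeries.constantCoeff (series e p p s) ≠ 0) :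
    ∃ f : g.ParseForest s, f.yield = [] := by
  by_contra! hne
  refine h ?_
  rw [← MvPowerSeries.coeff_zero_eq_constantCoeff_apply, coeff_series]
  have : IsEmpty (SortedForest e p p s 0) :=
    ⟨fun f ↦ hne f.1 (by simpa [sortedWord] using f.2.eq_zero_and_eq_sortedWord.2)⟩
  simp

/-- A nonzero constant term comes from an occurrence of `B` in `s` whose neighbours all have trees
with empty yield; these surround any tree as `B`. -/
lemma exists_map_of_constantCoeff_leibnizCoeff_ne_zero {e : Fin 3 → T} {p q : Fin 3}
    {s : List (Symbol T g.NT)} {B : g.Useful}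
    (h : MvPowerSeries.constantCoeff (leibnizCoeff (series e p p) (series e q q) s B) ≠ 0) :
    ∃ φ : g.ParseForest [.nonterminal B.1] → g.ParseForest s,
      ∀ t, (φ t).yield = t.yield ∧ t.size ≤ (φ t).size := by
  induction s with
  | nil => simp [leibnizCoeff] at h
  | cons X s ih =>
    rw [leibnizCoeff, map_add] at h
    by_cases h₁ : MvPowerSeries.constantCoeff
        (series e p p [X] * leibnizCoeff (series e p p) (series e q q) s B) = 0
    · rw [h₁, zero_add] at h
      split_ifs at h with hX
      · subst hX
        obtain ⟨f, hf⟩ := exists_yield_eq_nil h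
        exact ⟨fun t ↦ cons t f, fun t ↦ by simp [hf]⟩
      · simp at h
    · rw [map_mul] at h₁
      obtain ⟨t₀, ht₀⟩ := exists_yield_eq_nil (left_ne_zero_of_mul h₁)
      obtain ⟨φ, hφ⟩ := ih (right_ne_zero_of_mul h₁)
      exact ⟨fun t ↦ cons t₀ (φ t), fun t ↦ by simp [ht₀, hφ, (hφ t).2.trans]⟩

/-- Each tree as one nonterminal can be enlarged to a tree as the other with the same yield. -/
def Enlarges (B A : g.Useful) : Prop :=
  ∃ φ : g.ParseForest [.nonterminal B.1] → g.ParseForest [.nonterminal A.1],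
    ∀ t, (φ t).yield = t.yield ∧ t.size < (φ t).size

/-- The rule node added at the root makes the inequality of sizes strict. -/
lemma enlarges_of_constantCoeff_leibnizMatrix_ne_zero {e : Fin 3 → T} {p q : Fin 3}
    {A B : g.Useful}
    (h : MvPowerSeries.constantCoeff (leibnizMatrix (series e p p) (series e q q) A B) ≠ 0) :
    Enlarges B A := by
  rw [leibnizMatrix, map_sum] at h
  obtain ⟨r, hr, h⟩ := Finset.exists_ne_zero_of_sum_ne_zero h
  obtain ⟨φ, hφ⟩ := exists_map_of_constantCoeff_leibnizCoeff_ne_zero h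
  obtain ⟨hr, hA, -⟩ := mem_productiveRules.1 hr
  refine ⟨fun t ↦ (nodeEquiv A.1).symm ⟨⟨r, hr, hA⟩, φ t⟩, fun t ↦ ?_⟩
  simpa [Nat.lt_succ_iff] using hφ t

/-- If `A` enlarged itself, iteration would give infinitely many trees with one yield. On a finite
type, transitivity and irreflexivity suffice. -/
lemma wellFounded_enlarges (hg : g.IsFinitelyAmbiguous) :
    WellFounded (Enlarges : g.Useful → g.Useful → Prop) := by
  have : IsTrans g.Useful Enlarges := ⟨fun A B C ⟨φ, hφ⟩ ⟨ψ, hψ⟩ ↦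
    ⟨ψ ∘ φ, fun t ↦ ⟨(hψ _).1.trans (hφ _).1, (hφ _).2.trans (hψ _).2⟩⟩⟩
  have : Std.Irrefl (Enlarges : g.Useful → g.Useful → Prop) := by
    refine ⟨fun A ⟨φ, hφ⟩ ↦ ?_⟩
    obtain ⟨t⟩ := A.2.nonempty
    have hy (n : ℕ) : (φ^[n] t).yield = t.yield := by
      induction n with
      | zero => rfl
      | succ n ih => rw [Function.iterate_succ_apply', (hφ _).1, ih]
    have hm : StrictMono fun n ↦ (φ^[n] t).size := strictMono_nat_of_lt_succ fun n ↦ by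
      rw [Function.iterate_succ_apply']
      exact (hφ _).2
    have := A.2.finite hg t.yield
    exact not_injective_infinite_finite
      (fun n ↦ (⟨φ^[n] t, hy n⟩ : {f : g.ParseForest [.nonterminal A.1] // f.yield = t.yield}))
      fun m n h ↦ hm.injective (congrArg (fun x ↦ x.1.size) h)
  exact Finite.wellFounded_of_trans_of_irrefl _

/-- The constant part of the matrix is supported on the well-founded relation `Enlarges`, so a
vector that it fixes vanishes by induction. -/
lemma det_one_sub_leibnizMatrix_ne_zero (hg : g.IsFinitelyAmbiguous) (e : Fin 3 → T)
    (p q : Fin 3) :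
    (1 - leibnizMatrix (g := g) (series e p p) (series e q q)).det ≠ 0 := by
  intro h
  have h₀ := congrArg MvPowerSeries.constantCoeff h
  rw [RingHom.map_det, map_zero, map_sub, map_one] at h₀
  obtain ⟨v, hv, hv'⟩ := Matrix.exists_mulVec_eq_zero_iff.2 h₀
  rw [Matrix.sub_mulVec, Matrix.one_mulVec, sub_eq_zero] at hv'
  refine hv (funext fun A ↦ ?_)
  induction A using (wellFounded_enlarges hg).induction with
  | _ A ih =>
    rw [hv', Matrix.mulVec, dotProduct]
    refine Finset.sum_eq_zero fun B _ ↦ ?_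
    by_cases hAB : MvPowerSeries.constantCoeff
        (leibnizMatrix (series e p p) (series e q q) A B) = 0
    · simp [hAB]
    · rw [ih B (enlarges_of_constantCoeff_leibnizMatrix_ne_zero hAB), Pi.zero_apply, mul_zero]

/-- The linear system given by a grammar has only the trivial solution. -/
theorem eq_zero_of_leibniz (hg : g.IsFinitelyAmbiguous) (e : Fin 3 → T) (p q : Fin 3)
    {K E W : Type*} [Field K] [Algebra (MvPowerSeries (Fin 3) (ZMod 2)) K]
    [FaithfulSMul (MvPowerSeries (Fin 3) (ZMod 2)) K] [Field E] (ι : E →+* K)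
    [AddCommGroup W] [Module E W] {f h : List (Symbol T g.NT) → E}
    (hf : ∀ s, g.IsUseful s → ι (f s) = algebraMap _ K (series e p p s))
    (hh : ∀ s, g.IsUseful s → ι (h s) = algebraMap _ K (series e q q s))
    {G : List (Symbol T g.NT) → W} (hnil : G [] = 0) (hterm : ∀ x, G [.terminal x] = 0)
    (hcons : ∀ X s, g.IsUseful (X :: s) → G (X :: s) = f [X] • G s + h s • G [X])
    (hrule : ∀ A, g.IsUseful [.nonterminal A] →
      G [.nonterminal A] = ∑ r ∈ productiveRules A, G r.output)
    {s : List (Symbol T g.NT)} (hs : g.IsUseful s) : G s = 0 := by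
  have expand {s : List (Symbol T g.NT)} (hs : g.IsUseful s) :
      G s = ∑ B : g.Useful, leibnizCoeff f h s B • G [.nonterminal B.1] := by
    induction s with
    | nil => simp [hnil, leibnizCoeff]
    | cons X s ih =>
      rw [hcons X s hs, ih hs.tail]
      simp only [leibnizCoeff, add_smul, mul_smul, Finset.sum_add_distrib, Finset.smul_sum]
      congr 1
      cases X with
      | terminal x => simp [hterm]
      | nonterminal A =>
        rw [Finset.sum_eq_single (⟨A, hs.head⟩ : g.Useful)]
        · simp
        · intro B _ hB
          rw [if_neg, zero_smul]
          rintro hAB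
          exact hB (Subtype.ext (Symbol.nonterminal.inj hAB).symm)
        · simp
  -- The entries live in `E`; `ι` carries them to `K`, where they agree with the power series
  -- entries.
  have hdet : (1 - leibnizMatrix f h).det ≠ 0 := by
    intro h0
    have h1 : ι.mapMatrix (leibnizMatrix f h) =
        (algebraMap _ K).mapMatrix (leibnizMatrix (g := g) (series e p p) (series e q q)) := by
      rw [map_leibnizMatrix ι hf hh]
      exact (map_leibnizMatrix (algebraMap _ K) (fun _ _ ↦ rfl) fun _ _ ↦ rfl).symm
    have h2 := congrArg ι h0
    rw [RingHom.map_det, map_sub, map_one, h1, map_zero, ← RingHom.map_one (algebraMap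
      (MvPowerSeries (Fin 3) (ZMod 2)) K).mapMatrix, ← RingHom.map_sub, ← RingHom.map_det] at h2
    exact det_one_sub_leibnizMatrix_ne_zero hg e p q
      ((FaithfulSMul.algebraMap_eq_zero_iff _ K).1 h2)
  have system (A : g.Useful) :
      ∑ B, (1 - leibnizMatrix f h) A B • G [.nonterminal B.1] = 0 := by
    simp only [Matrix.sub_apply, sub_smul, Finset.sum_sub_distrib, Matrix.one_apply, ite_smul,
      one_smul, zero_smul, Finset.sum_ite_eq, Finset.mem_univ, if_true, leibnizMatrix,
      Finset.sum_smul]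
    rw [Finset.sum_comm, hrule A.1 A.2, sub_eq_zero]
    exact Finset.sum_congr rfl fun r hr ↦ expand (A.2.of_mem_productiveRules hr)
  -- Cramer's rule: multiply the system by the adjugate.
  have hG (C : g.Useful) : G [.nonterminal C.1] = 0 := by
    refine (smul_eq_zero_iff_right hdet).1 ?_
    calc (1 - leibnizMatrix f h).det • G [.nonterminal C.1]
        = ∑ B, ((1 - leibnizMatrix f h).det • (1 : Matrix g.Useful g.Useful E)) C B •
            G [.nonterminal B.1] := by
          simp [Matrix.one_apply, ite_smul]
      _ = ∑ A, (1 - leibnizMatrix f h).adjugate C A •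
            ∑ B, (1 - leibnizMatrix f h) A B • G [.nonterminal B.1] := by
          rw [← Matrix.adjugate_mul]
          simp only [Matrix.mul_apply, Finset.sum_smul, Finset.smul_sum, mul_smul]
          exact Finset.sum_comm
      _ = 0 := by simp only [system, smul_zero, Finset.sum_const_zero]
  rw [expand hs]
  exact Finset.sum_eq_zero fun B _ ↦ by rw [hG, smul_zero]

end ContextFreeGrammar

/-! ### Algebraicity of the diagonal series and linearity of the others. -/

/-- An extension generated by finitely many elements that every derivation kills is algebraic. -/
lemma IntermediateField.isAlgebraic_adjoin_of_derivation {k K : Type*} [Field k] [Field K]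
    [Algebra k K] {S : Set K} (hS : S.Finite)
    (hD : ∀ x (hx : x ∈ S), KaehlerDifferential.D k (adjoin k S) ⟨x, subset_adjoin k S hx⟩ = 0) :
    Algebra.IsAlgebraic k (adjoin k S) := by
  have hD' (x : K) (hx : x ∈ adjoin k S) : KaehlerDifferential.D k (adjoin k S) ⟨x, hx⟩ = 0 := by
    induction hx using adjoin_induction with
    | mem x hx => exact hD x hx
    | algebraMap x => exact (KaehlerDifferential.D k (adjoin k S)).map_algebraMap x
    | add x y hx hy h₁ h₂ =>
      change KaehlerDifferential.D k (adjoin k S) (⟨x, hx⟩ + ⟨y, hy⟩) = 0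
      rw [map_add, h₁, h₂, add_zero]
    | inv x hx h =>
      change KaehlerDifferential.D k (adjoin k S) (⟨x, hx⟩⁻¹) = 0
      rw [Derivation.leibniz_inv, h, smul_zero]
    | mul x y hx hy h₁ h₂ =>
      change KaehlerDifferential.D k (adjoin k S) (⟨x, hx⟩ * ⟨y, hy⟩) = 0
      rw [Derivation.leibniz, h₁, h₂, smul_zero, smul_zero, add_zero]
  -- A finitely generated field extension without differentials is separable algebraic, also in
  -- characteristic two.
  have : Algebra.EssFiniteType k (adjoin k S) :=
    essFiniteType_iff.2 (fg_adjoin_of_finite hS)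
  have : Algebra.FormallyUnramified k (adjoin k S) := by
    refine ⟨(Submodule.subsingleton_iff (adjoin k S)).1 (subsingleton_of_bot_eq_top ?_)⟩
    rw [← KaehlerDifferential.span_range_derivation, eq_comm, Submodule.span_eq_bot]
    rintro _ ⟨x, rfl⟩
    exact hD' x.1 x.2
  have := Algebra.FormallyUnramified.isSeparable k (adjoin k S)
  infer_instance

instance : IsDomain (MvPowerSeries (Fin 3) (ZMod 2)) := NoZeroDivisors.to_isDomain _

/-- The field of fractions of the ring of power series in three variables. -/
abbrev SeriesField : Type := FractionRing (MvPowerSeries (Fin 3) (ZMod 2))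

/-- The embedding of power series into their field of fractions. -/
noncomputable abbrev toSeriesField : MvPowerSeries (Fin 3) (ZMod 2) →+* SeriesField :=
  algebraMap _ _

namespace ContextFreeGrammar

variable {T : Type*} {g : ContextFreeGrammar T} {e : Fin 3 → T}

/-- Indices never decrease along a run, so a run from `p` to `p` passes only through `p`. -/
lemma series_self_cons (hg : g.IsFinitelyAmbiguous) (he : Function.Injective e) (p : Fin 3)
    {X : Symbol T g.NT} {s : List (Symbol T g.NT)} (h : g.IsUseful (X :: s)) :
    series e p p (X :: s) = series e p p [X] * series e p p s := by
  rw [series_cons hg he h]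
  refine Fintype.sum_eq_single p fun r hr ↦ ?_
  rcases hr.lt_or_gt with h | h
  · rw [series_eq_zero h, zero_mul]
  · rw [series_eq_zero (p := r) h, mul_zero]

/-- A derivation that kills the diagonal series of terminals kills those of useful strings. -/
lemma derivation_series_self (hg : g.IsFinitelyAmbiguous) (he : Function.Injective e) (p : Fin 3)
    {k L K W : Type*} [Field k] [Field L] [Field K] [Algebra k L] [Algebra L K]
    [Algebra (MvPowerSeries (Fin 3) (ZMod 2)) K] [FaithfulSMul (MvPowerSeries (Fin 3) (ZMod 2)) K]
    [AddCommGroup W] [Module L W] [Module k W] (D : Derivation k L W)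
    {f : List (Symbol T g.NT) → L}
    (hf : ∀ s, g.IsUseful s → algebraMap L K (f s) = algebraMap _ K (series e p p s))
    (hnil : f [] = 1) (hterm : ∀ x, D (f [.terminal x]) = 0)
    {s : List (Symbol T g.NT)} (hs : g.IsUseful s) : D (f s) = 0 := by
  refine eq_zero_of_leibniz (f := f) (h := f) (G := fun s ↦ D (f s)) hg e p p (algebraMap L K)
    hf hf (by simp [hnil]) hterm ?_ ?_ hs
  · intro X s h
    have : f (X :: s) = f [X] * f s := (algebraMap L K).injective (by
      rw [map_mul, hf _ h, hf _ h.head, hf _ h.tail, series_self_cons hg he p h, map_mul])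
    rw [this, Derivation.leibniz]
  · intro A h
    have : f [.nonterminal A] = ∑ r ∈ productiveRules A, f r.output :=
      (algebraMap L K).injective (by
        rw [hf _ h, series_nonterminal hg h, map_sum, map_sum]
        exact Finset.sum_congr rfl fun r hr ↦ (hf _ (h.of_mem_productiveRules hr)).symm)
    rw [this, map_sum]

/-- The diagonal series of a grammar are algebraic over every field that contains the variable. -/
lemma isAlgebraic_series_self (hg : g.IsFinitelyAmbiguous) (he : Function.Injective e) (p : Fin 3)
    {k K : Type*} [Field k] [Field K] [Algebra k K]
    [Algebra (MvPowerSeries (Fin 3) (ZMod 2)) K] [FaithfulSMul (MvPowerSeries (Fin 3) (ZMod 2)) K]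
    (hk : algebraMap _ K (MvPowerSeries.X p : MvPowerSeries (Fin 3) (ZMod 2)) ∈
      (algebraMap k K).range)
    {s : List (Symbol T g.NT)} (hs : g.IsUseful s) :
    IsAlgebraic k (algebraMap _ K (series e p p s)) := by
  classical
  set S : Set K := Set.range fun A : g.Useful ↦ algebraMap _ K (series e p p [.nonterminal A.1])
  set L := IntermediateField.adjoin k S
  have hterm (x : T) : ∃ y : k,
      algebraMap k K y = algebraMap _ K (series e p p ([.terminal x] : List (Symbol T g.NT))) := by
    rcases series_terminal (g := g) (p := p) (q := p) he x with h | h <;> rw [h]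
    · exact ⟨0, by rw [map_zero, map_zero]⟩
    · exact hk
  have hL {s : List (Symbol T g.NT)} (hs : g.IsUseful s) :
      algebraMap _ K (series e p p s) ∈ L := by
    induction s with
    | nil => rw [series_nil, if_pos rfl, map_one]; exact one_mem L
    | cons X s ih =>
      rw [series_self_cons hg he p hs, map_mul]
      refine mul_mem ?_ (ih hs.tail)
      cases X with
      | terminal x =>
        obtain ⟨y, hy⟩ := hterm x
        exact hy ▸ L.algebraMap_mem y
      | nonterminal A => exact IntermediateField.subset_adjoin _ _ ⟨⟨A, hs.head⟩, rfl⟩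
  -- The default value is harmless: only useful strings, single terminals and `[]` matter, and their
  -- series lie in `L`.
  let f (s : List (Symbol T g.NT)) : L :=
    if h : algebraMap _ K (series e p p s) ∈ L then ⟨_, h⟩ else 0
  have hf {s : List (Symbol T g.NT)} (h : algebraMap _ K (series e p p s) ∈ L) :
      algebraMap L K (f s) = algebraMap _ K (series e p p s) := by
    simp only [f, dif_pos h, IntermediateField.algebraMap_apply]
  have : Algebra.IsAlgebraic k L := by
    refine IntermediateField.isAlgebraic_adjoin_of_derivation (Set.finite_range _) fun x hx ↦ ?_
    obtain ⟨A, rfl⟩ := hx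
    have hA : f [.nonterminal A.1] = ⟨_, IntermediateField.subset_adjoin k S ⟨A, rfl⟩⟩ :=
      Subtype.ext (hf (hL A.2))
    rw [← hA]
    refine derivation_series_self hg he p (KaehlerDifferential.D k L) (fun s hs ↦ hf (hL hs))
      ?_ (fun x ↦ ?_) A.2
    · have h1 : algebraMap _ K (series e p p ([] : List (Symbol T g.NT))) = 1 := by
        rw [series_nil, if_pos rfl, map_one]
      refine (algebraMap L K).injective ?_
      rw [hf (h1 ▸ one_mem L), h1, map_one]
    · obtain ⟨y, hy⟩ := hterm x
      have : f [.terminal x] = algebraMap k L y := (algebraMap L K).injective (by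
        rw [hf (hy ▸ L.algebraMap_mem y), ← hy, ← IsScalarTower.algebraMap_apply])
      rw [this, Derivation.map_algebraMap]
  exact IntermediateField.isAlgebraic_iff.1 (Algebra.IsAlgebraic.isAlgebraic (⟨_, hL hs⟩ : L))

/-- An off-diagonal series of a grammar lies in a linear subspace if the parts of it that cross the
intermediate indices do. -/
lemma series_mem_of_linear (hg : g.IsFinitelyAmbiguous) (he : Function.Injective e) {p q : Fin 3}
    (hpq : p < q) {E : IntermediateField (ZMod 2) SeriesField} (V : Submodule E SeriesField)
    (hp : ∀ s, g.IsUseful s → toSeriesField (series e p p s) ∈ E)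
    (hq : ∀ s, g.IsUseful s → toSeriesField (series e q q s) ∈ E)
    (hX : toSeriesField (MvPowerSeries.X q) ∈ V)
    (hV : ∀ X s, g.IsUseful (X :: s) → ∀ r, p < r → r < q →
      toSeriesField (series e p r [X]) * toSeriesField (series e r q s) ∈ V)
    {s : List (Symbol T g.NT)} (hs : g.IsUseful s) : toSeriesField (series e p q s) ∈ V := by
  classical
  let f (i : Fin 3) (s : List (Symbol T g.NT)) : E :=
    if h : toSeriesField (series e i i s) ∈ E then ⟨_, h⟩ else 0
  have hf {i : Fin 3} {s : List (Symbol T g.NT)} (h : toSeriesField (series e i i s) ∈ E) :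
      (f i s : SeriesField) = toSeriesField (series e i i s) := by
    simp only [f, dif_pos h]
  -- Modulo `V` the inhomogeneous terms disappear, so the homogeneous uniqueness theorem applies.
  rw [← Submodule.Quotient.mk_eq_zero]
  refine eq_zero_of_leibniz (f := f p) (h := f q)
    (G := fun s ↦ (Submodule.Quotient.mk (toSeriesField (series e p q s)) : SeriesField ⧸ V))
    hg e p q (algebraMap E SeriesField) (fun s hs ↦ hf (hp s hs)) (fun s hs ↦ hf (hq s hs))
    ?_ ?_ ?_ ?_ hs
  · rw [series_nil, if_neg hpq.ne, map_zero]; rfl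
  · intro x
    rw [Submodule.Quotient.mk_eq_zero]
    rcases series_terminal (g := g) (p := p) (q := q) he x with h | h <;> rw [h]
    · rw [map_zero]; exact zero_mem V
    · exact hX
  · intro X s h
    rw [← Submodule.Quotient.mk_smul, ← Submodule.Quotient.mk_smul, ← Submodule.Quotient.mk_add,
      Submodule.Quotient.eq]
    simp only [Algebra.smul_def, IntermediateField.algebraMap_apply, hf (hp _ h.head),
      hf (hq _ h.tail)]
    -- The summands `r = p` and `r = q` are the two Leibniz terms; the rest must lie in `V`.
    rw [series_cons hg he h, map_sum, ← Finset.add_sum_erase _ _ (Finset.mem_univ p),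
      ← Finset.add_sum_erase (Finset.univ.erase p) _
        (Finset.mem_erase.2 ⟨hpq.ne', Finset.mem_univ q⟩), map_mul, map_mul,
      mul_comm (toSeriesField (series e q q s)), ← add_assoc, add_sub_cancel_left]
    refine sum_mem fun r hr ↦ ?_
    simp only [Finset.mem_erase, Finset.mem_univ, and_true] at hr
    rcases lt_or_ge r p with hrp | hrp
    · rw [series_eq_zero hrp, zero_mul, map_zero]; exact zero_mem V
    rcases lt_or_ge q r with hqr | hqr
    · rw [series_eq_zero (p := r) hqr, mul_zero, map_zero]; exact zero_mem V
    rw [map_mul]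
    exact hV X s h r (lt_of_le_of_ne hrp (Ne.symm hr.2)) (lt_of_le_of_ne hqr hr.1)
  · intro A h
    simp only [← Submodule.mkQ_apply]
    rw [series_nonterminal hg h, map_sum, map_sum]

end ContextFreeGrammar

/-! ### Specialization to product one, and integrality. -/

section PowerSeries

open MvPolynomial

/-- The exponent map of the specialization of three variables with product one. -/
def cyclicDifference : (Fin 3 →₀ ℕ) →+ (Fin 3 → ℤ) where
  toFun d j := (d j : ℤ) - d (j + 1)
  map_zero' := by ext; simp
  map_add' d d' := by ext; simp; ring

/-- The specialization to Laurent polynomials under which the product of the variables is one. -/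
noncomputable def specialize :
    MvPolynomial (Fin 3) (ZMod 2) →+* AddMonoidAlgebra (ZMod 2) (Fin 3 → ℤ) :=
  AddMonoidAlgebra.mapDomainRingHom (ZMod 2) cyclicDifference

lemma specialize_prod : specialize (1 - monomial (Finsupp.equivFunOnFinite.symm 1) 1) = 0 := by
  rw [map_sub, map_one, sub_eq_zero]
  change _ = AddMonoidAlgebra.mapDomain cyclicDifference (AddMonoidAlgebra.single _ _)
  rw [AddMonoidAlgebra.mapDomain_single, AddMonoidAlgebra.one_def]
  congr 1

/-- Exponents with equal cyclic differences differ by a multiple of `(1, 1, 1)`, which is zero when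
both vanish at `o`. -/
lemma specialize_rename_injective (o : Fin 3) :
    Function.Injective fun f : MvPolynomial {j : Fin 3 // j ≠ o} (ZMod 2) ↦
      specialize (rename Subtype.val f) := by
  have : (fun f : MvPolynomial {j : Fin 3 // j ≠ o} (ZMod 2) ↦ specialize (rename Subtype.val f)) =
      AddMonoidAlgebra.mapDomain (cyclicDifference ∘ Finsupp.mapDomain Subtype.val) := by
    ext1 f
    exact congrArg AddMonoidAlgebra.ofCoeff Finsupp.mapDomain_comp.symm
  rw [this]
  refine AddMonoidAlgebra.mapDomain_injective fun d d' h ↦ ?_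
  refine Finsupp.mapDomain_injective Subtype.val_injective ?_
  have ho (d : {j : Fin 3 // j ≠ o} →₀ ℕ) : Finsupp.mapDomain Subtype.val d o = 0 :=
    Finsupp.mapDomain_of_notMem_range _ _ (by simp)
  have h₁ := ho d
  have h₂ := ho d'
  simp only [Function.comp_apply] at h
  generalize Finsupp.mapDomain Subtype.val d = m at h h₁
  generalize Finsupp.mapDomain Subtype.val d' = m' at h h₂
  have h0 := congrFun h 0
  have h1 := congrFun h 1
  have h2 := congrFun h 2
  simp only [cyclicDifference, AddMonoidHom.coe_mk, ZeroHom.coe_mk] at h0 h1 h2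
  norm_num at h0 h1 h2
  rw [show (2 : Fin 3) + 1 = 0 from rfl] at h2
  ext j
  fin_cases o <;> fin_cases j <;> simp at * <;> omega

/-- Polynomials as elements of the field of fractions of power series. -/
noncomputable abbrev polyToSeriesField : MvPolynomial (Fin 3) (ZMod 2) →+* SeriesField :=
  toSeriesField.comp coeToMvPowerSeries.ringHom

lemma polyToSeriesField_injective : Function.Injective polyToSeriesField :=
  (IsFractionRing.injective (MvPowerSeries (Fin 3) (ZMod 2)) SeriesField).comp
    (coe_injective _ _)

/-- The fractions whose denominators do not vanish under `specialize`. -/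
noncomputable def regularSubring : Subring SeriesField where
  carrier := {u | ∃ f h, specialize h ≠ 0 ∧ u * polyToSeriesField h = polyToSeriesField f}
  mul_mem' := by
    rintro u v ⟨f, h, hh, hu⟩ ⟨f', h', hh', hv⟩
    refine ⟨f * f', h * h', ?_, ?_⟩
    · rw [map_mul]; exact mul_ne_zero hh hh'
    · rw [map_mul, map_mul, ← hu, ← hv]; ring
  one_mem' := ⟨1, 1, by simp, by simp⟩
  add_mem' := by
    rintro u v ⟨f, h, hh, hu⟩ ⟨f', h', hh', hv⟩
    refine ⟨f * h' + f' * h, h * h', ?_, ?_⟩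
    · rw [map_mul]; exact mul_ne_zero hh hh'
    · rw [map_mul, map_add, map_mul, map_mul, ← hu, ← hv]; ring
  zero_mem' := ⟨0, 1, by simp, by simp⟩
  neg_mem' := by
    rintro u ⟨f, h, hh, hu⟩
    exact ⟨-f, h, hh, by rw [map_neg, ← hu, neg_mul]⟩

lemma polyToSeriesField_mem_regularSubring (f : MvPolynomial (Fin 3) (ZMod 2)) :
    polyToSeriesField f ∈ regularSubring :=
  ⟨f, 1, by simp, by simp⟩

/-- The elements that are integral over `regularSubring`. -/
noncomputable abbrev integralSubring : Subring SeriesField :=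
  (integralClosure regularSubring SeriesField).toSubring

lemma mem_integralSubring_of_mem {u : SeriesField} (hu : u ∈ regularSubring) :
    u ∈ integralSubring :=
  isIntegral_algebraMap (x := (⟨u, hu⟩ : regularSubring))

/-- A fraction whose denominator vanishes under `specialize` is not integral. -/
lemma notMem_integralSubring {h : MvPolynomial (Fin 3) (ZMod 2)} (hh : specialize h = 0)
    {u : SeriesField} (hu : u * polyToSeriesField h = 1) : u ∉ integralSubring := by
  intro hmem
  let O := integralClosure regularSubring SeriesField
  let y : regularSubring := ⟨_, polyToSeriesField_mem_regularSubring h⟩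
  have hy : IsUnit (algebraMap regularSubring O y) :=
    IsUnit.of_mul_eq_one (⟨u, hmem⟩ : O) (Subtype.ext ((mul_comm _ _).trans hu))
  -- Units are reflected by integral extensions, so the inverse of `h` is already a regular fraction
  -- `f / h'`, whence `h' = h * f`.
  obtain ⟨z, hz⟩ := ((isUnit_map_iff (algebraMap regularSubring O) y).1 hy).exists_right_inv
  obtain ⟨f, h', hh', hz'⟩ := z.2
  have hz : polyToSeriesField h * z = 1 := congrArg Subtype.val hz
  refine hh' ?_
  have : h' = h * f := polyToSeriesField_injective (by
    rw [map_mul, ← hz', ← mul_assoc, hz, one_mul])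
  rw [this, map_mul, hh, zero_mul]

/-- The field of rational functions in the variables other than a given one. -/
noncomputable def rationalField (o : Fin 3) : IntermediateField (ZMod 2) SeriesField :=
  IntermediateField.adjoin _
    (Set.range fun j : {j : Fin 3 // j ≠ o} ↦ toSeriesField (MvPowerSeries.X j.1))

lemma X_mem_rationalField {o j : Fin 3} (h : j ≠ o) :
    toSeriesField (MvPowerSeries.X j) ∈ rationalField o :=
  IntermediateField.subset_adjoin _ _ ⟨⟨j, h⟩, rfl⟩

lemma aeval_eq_polyToSeriesField (o : Fin 3) (f : MvPolynomial {j : Fin 3 // j ≠ o} (ZMod 2)) :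
    aeval (fun j : {j : Fin 3 // j ≠ o} ↦ toSeriesField (MvPowerSeries.X j.1)) f =
      polyToSeriesField (rename Subtype.val f) := by
  induction f using MvPolynomial.induction_on with
  | C r =>
    rw [rename_C, aeval_C]
    exact RingHom.congr_fun (Subsingleton.elim (algebraMap (ZMod 2) SeriesField)
      (polyToSeriesField.comp C)) r
  | add f f' h h' => rw [map_add, map_add, map_add, h, h']
  | mul_X f j h => simp [h]

lemma mem_regularSubring_of_mem_rationalField {o : Fin 3} {u : SeriesField}
    (hu : u ∈ rationalField o) : u ∈ regularSubring := by
  obtain ⟨f, h, rfl⟩ := (IntermediateField.mem_adjoin_range_iff _ _ _).1 hu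
  rw [aeval_eq_polyToSeriesField, aeval_eq_polyToSeriesField]
  by_cases h0 : h = 0
  · rw [h0, map_zero, map_zero, div_zero]
    exact zero_mem _
  · refine ⟨rename Subtype.val f, rename Subtype.val h, fun h1 ↦ h0 ?_, div_mul_cancel₀ _ ?_⟩
    · exact specialize_rename_injective o (by simpa using h1)
    · rw [Ne, map_eq_zero_iff _ polyToSeriesField_injective,
        map_eq_zero_iff _ (rename_injective _ Subtype.val_injective)]
      exact h0

/-- The elements that are algebraic over `rationalField o`. -/
noncomputable def algebraicField (o : Fin 3) : IntermediateField (ZMod 2) SeriesField :=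
  (algebraicClosure (rationalField o) SeriesField).restrictScalars (ZMod 2)

lemma mem_algebraicField {o : Fin 3} {u : SeriesField} :
    u ∈ algebraicField o ↔ IsAlgebraic (rationalField o) u := by
  rw [algebraicField, IntermediateField.mem_restrictScalars, mem_algebraicClosure_iff]

/-- Over a field, algebraic elements have monic equations, and `rationalField o` lies in
`regularSubring`. -/
lemma mem_integralSubring_of_mem_algebraicField {o : Fin 3} {u : SeriesField}
    (hu : u ∈ algebraicField o) : u ∈ integralSubring := by
  obtain ⟨P, hP, hPu⟩ := (mem_algebraicField.1 hu).isIntegral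
  let ι : rationalField o →+* regularSubring :=
    (rationalField o).val.toRingHom.codRestrict regularSubring
      fun x ↦ mem_regularSubring_of_mem_rationalField x.2
  refine ⟨P.map ι, hP.map ι, ?_⟩
  rw [Polynomial.eval₂_map]
  exact hPu

/-! ### Integrality of the series of a grammar. -/

namespace ContextFreeGrammar

variable {T : Type*} {g : ContextFreeGrammar T} {e : Fin 3 → T}

lemma series_self_mem_algebraicField (hg : g.IsFinitelyAmbiguous) (he : Function.Injective e)
    {p o : Fin 3} (h : p ≠ o) {s : List (Symbol T g.NT)} (hs : g.IsUseful s) :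
    toSeriesField (series e p p s) ∈ algebraicField o :=
  mem_algebraicField.2 (isAlgebraic_series_self hg he p ⟨⟨_, X_mem_rationalField h⟩, rfl⟩ hs)

lemma X_mem_algebraicField {o j : Fin 3} (h : j ≠ o) :
    toSeriesField (MvPowerSeries.X j) ∈ algebraicField o :=
  mem_algebraicField.2 (isAlgebraic_algebraMap (⟨_, X_mem_rationalField h⟩ : rationalField o))

lemma series_mem_algebraicField (hg : g.IsFinitelyAmbiguous) (he : Function.Injective e)
    {p q o : Fin 3} (hpq : p < q) (hr : ∀ r, p < r → ¬ r < q) (hp : p ≠ o) (hq : q ≠ o)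
    {s : List (Symbol T g.NT)} (hs : g.IsUseful s) :
    toSeriesField (series e p q s) ∈ algebraicField o := by
  -- The subspace is the one-dimensional copy of `algebraicField o` itself; there are no
  -- intermediate indices.
  have := series_mem_of_linear hg he hpq (E := algebraicField o)
    (LinearMap.range (Algebra.linearMap (algebraicField o) SeriesField))
    (fun s hs ↦ series_self_mem_algebraicField hg he hp hs)
    (fun s hs ↦ series_self_mem_algebraicField hg he hq hs)
    ⟨⟨_, X_mem_algebraicField hq⟩, rfl⟩ (fun _ _ _ r h₁ h₂ ↦ absurd h₂ (hr r h₁)) hs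
  obtain ⟨y, hy⟩ := this
  exact hy ▸ y.2

/-- The elements that are integral over `regularSubring`, as a vector space. -/
noncomputable def integralSubmodule (o : Fin 3) : Submodule (algebraicField o) SeriesField where
  carrier := integralSubring
  add_mem' := add_mem
  zero_mem' := zero_mem integralSubring
  smul_mem' c _ h := mul_mem (mem_integralSubring_of_mem_algebraicField c.2) h

/-- The series of a grammar are integral over `regularSubring`. -/
theorem series_zero_mem_integralSubring (hg : g.IsFinitelyAmbiguous) (he : Function.Injective e)
    (q : Fin 3) {s : List (Symbol T g.NT)} (hs : g.IsUseful s) :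
    toSeriesField (series e 0 q s) ∈ integralSubring := by
  have h01 {s : List (Symbol T g.NT)} (hs : g.IsUseful s) :=
    mem_integralSubring_of_mem_algebraicField (series_mem_algebraicField hg he
      (p := 0) (q := 1) (o := 2) (by decide) (by decide) (by decide) (by decide) hs)
  have h12 {s : List (Symbol T g.NT)} (hs : g.IsUseful s) :=
    mem_integralSubring_of_mem_algebraicField (series_mem_algebraicField hg he
      (p := 1) (q := 2) (o := 0) (by decide) (by decide) (by decide) (by decide) hs)
  fin_cases q
  · exact mem_integralSubring_of_mem_algebraicField
      (series_self_mem_algebraicField hg he (o := 2) (by decide) hs)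
  · exact h01 hs
  -- The three omitted variables differ: coefficients avoid variable 1, and the factors of the
  -- crossing term avoid 2 and 0. Only the integral closure contains all three fields.
  · refine series_mem_of_linear hg he (p := 0) (q := 2) (by decide) (integralSubmodule 1)
      (fun s hs ↦ series_self_mem_algebraicField hg he (by decide) hs)
      (fun s hs ↦ series_self_mem_algebraicField hg he (by decide) hs)
      (mem_integralSubring_of_mem_algebraicField (X_mem_algebraicField (o := 1) (by decide)))
      (fun X s h r h₁ h₂ ↦ ?_) hs
    obtain rfl : r = 1 := by omega
    exact integralSubring.mul_mem (h01 h.head) (h12 h.tail)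

/-- The sum of the series that start at the first index counts all trees for a sorted word. -/
lemma coeff_sum_series (hg : g.IsFinitelyAmbiguous) (he : Function.Injective e)
    (hs : g.IsUseful [.nonterminal g.initial]) (d : Fin 3 →₀ ℕ) :
    MvPowerSeries.coeff d (∑ q, series e 0 q [.nonterminal g.initial]) =
      (Nat.card (g.ParseTree g.initial (sortedWord e d)) : ZMod 2) := by
  have := fun q ↦ hs.finite_sortedForest hg e 0 q d
  let φ : (Σ q, SortedForest e 0 q [.nonterminal g.initial] d) →
      g.ParseTree g.initial (sortedWord e d) :=
    fun x ↦ ⟨x.2.1, x.2.2.eq_zero_and_eq_sortedWord.2⟩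
  have hφ : Function.Bijective φ := by
    constructor
    · rintro ⟨q, f, hf⟩ ⟨q', f', hf'⟩ h
      obtain rfl : f = f' := congrArg (fun x ↦ x.1) h
      obtain ⟨rfl, -⟩ := hf.unique he hf'
      rfl
    · rintro ⟨f, hf⟩
      obtain ⟨q, hq⟩ := exists_sortedRun_sortedWord e d
      exact ⟨⟨q, f, hf ▸ hq⟩, rfl⟩
  rw [← Nat.card_congr (Equiv.ofBijective φ hφ), Nat.card_sigma, map_sum, Nat.cast_sum]
  rfl

end ContextFreeGrammar

/-! ### The two explicit rational series. -/

section Indicator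

open Classical in
/-- The power series whose coefficients indicate a set of exponents. -/
noncomputable def indicatorSeries (P : (Fin 3 →₀ ℕ) → Prop) : MvPowerSeries (Fin 3) (ZMod 2) :=
  fun d ↦ if P d then 1 else 0

open Classical in
lemma coeff_indicatorSeries (P : (Fin 3 →₀ ℕ) → Prop) (d : Fin 3 →₀ ℕ) :
    MvPowerSeries.coeff d (indicatorSeries P) = if P d then 1 else 0 := rfl

/-- Geometric series: a shift-invariant set cancels against its translate by `m`, leaving the
exponents not above `m`. -/
lemma indicatorSeries_mul {P Q : (Fin 3 →₀ ℕ) → Prop} {m : Fin 3 →₀ ℕ}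
    (hP : ∀ d, P (d + m) ↔ P d) (hQ : ∀ d, Q d ↔ P d ∧ ¬ m ≤ d) :
    indicatorSeries P * (1 - monomial m 1 : MvPolynomial (Fin 3) (ZMod 2)) =
      indicatorSeries Q := by
  classical
  ext d
  rw [← coeToMvPowerSeries.ringHom_apply, map_sub, map_one, mul_sub, mul_one, map_sub,
    coeToMvPowerSeries.ringHom_apply, coe_monomial, MvPowerSeries.coeff_mul_monomial]
  simp only [coeff_indicatorSeries, hQ, mul_one]
  by_cases hm : m ≤ d
  · have := hP (d - m)
    rw [tsub_add_cancel_of_le hm] at this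
    simp [hm, this]
  · simp [hm]

lemma indicatorSeries_eq_zero : indicatorSeries (fun d ↦ d = 0) = 1 := by
  classical
  ext d
  rw [coeff_indicatorSeries, MvPowerSeries.coeff_one]
  congr

/-- The series of all monomials is rational with a denominator regular under `specialize`. -/
lemma indicatorSeries_true_mem_regularSubring :
    toSeriesField (indicatorSeries fun _ ↦ True) ∈ regularSubring := by
  let y (j : Fin 3) : MvPolynomial (Fin 3) (ZMod 2) := 1 - monomial (Finsupp.single j 1) 1
  have hy (j : Fin 3) : specialize (y j) ≠ 0 := by
    rw [map_sub, map_one, sub_ne_zero]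
    change _ ≠ AddMonoidAlgebra.mapDomain cyclicDifference (AddMonoidAlgebra.single _ _)
    rw [AddMonoidAlgebra.mapDomain_single, AddMonoidAlgebra.one_def]
    intro h
    have := ((AddMonoidAlgebra.single_left_inj one_ne_zero).1 h)
    have := congrFun this j
    fin_cases j <;> simp [cyclicDifference] at this
  have h : indicatorSeries (fun _ ↦ True) * (y 0) * (y 1) * (y 2) = 1 := by
    rw [indicatorSeries_mul (Q := fun d ↦ d 0 = 0),
      indicatorSeries_mul (Q := fun d ↦ d 0 = 0 ∧ d 1 = 0),
      indicatorSeries_mul (Q := fun d ↦ d = 0), indicatorSeries_eq_zero]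
    · simp
    · intro d
      rw [Finsupp.single_le_iff, Finsupp.ext_iff, Fin.forall_fin_succ, Fin.forall_fin_two]
      simp
      omega
    · simp
    · intro d
      rw [Finsupp.single_le_iff]
      omega
    · simp
    · intro d
      rw [Finsupp.single_le_iff]
      simp
  refine ⟨1, y 0 * y 1 * y 2, ?_, ?_⟩
  · rw [map_mul, map_mul]
    exact mul_ne_zero (mul_ne_zero (hy 0) (hy 1)) (hy 2)
  · rw [map_one, ← map_one toSeriesField, ← h]
    simp [mul_assoc]

lemma indicatorSeries_diagonal_notMem_integralSubring :
    toSeriesField (indicatorSeries fun d ↦ d 0 = d 1 ∧ d 1 = d 2) ∉ integralSubring := by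
  refine notMem_integralSubring specialize_prod ?_
  have h := indicatorSeries_mul (P := fun d ↦ d 0 = d 1 ∧ d 1 = d 2) (Q := fun d ↦ d = 0)
    (m := Finsupp.equivFunOnFinite.symm 1) (by simp) fun d ↦ by
      simp only [Finsupp.ext_iff, Finsupp.le_def, Fin.forall_fin_succ]
      simp
      omega
  rw [← map_one toSeriesField, ← indicatorSeries_eq_zero, ← h, map_mul]
  rfl

end Indicator

/-! ### Conclusion. -/

lemma sortedWord_mem_neOrNeLanguage {T : Type*} {a b c : T}
    (he : Function.Injective ![a, b, c]) (d : Fin 3 →₀ ℕ) :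
    sortedWord ![a, b, c] d ∈ neOrNeLanguage a b c ↔ ¬ (d 0 = d 1 ∧ d 1 = d 2) := by
  constructor
  · rintro ⟨n, m, l, h, hw⟩
    let d' : Fin 3 →₀ ℕ := Finsupp.equivFunOnFinite.symm ![n, m, l]
    have hw' : sortedWord ![a, b, c] d = sortedWord ![a, b, c] d' := hw
    obtain ⟨q, hq⟩ := exists_sortedRun_sortedWord ![a, b, c] d
    obtain ⟨q', hq'⟩ := exists_sortedRun_sortedWord ![a, b, c] d'
    obtain rfl := ((hw' ▸ hq).unique he hq').2
    change ¬ (n = m ∧ m = l)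
    omega
  · intro h
    exact ⟨d 0, d 1, d 2, by omega, rfl⟩

theorem GF2Grammar.language_ne_neOrNeLanguage {T : Type*} {a b c : T}
    (he : Function.Injective ![a, b, c]) (G : GF2Grammar T) :
    G.language ≠ neOrNeLanguage a b c := by
  intro hL
  have hg : G.toCFG.IsFinitelyAmbiguous := G.finite_parseTree
  have hcard (d : Fin 3 →₀ ℕ) :
      Odd (Nat.card (G.toCFG.ParseTree G.toCFG.initial (sortedWord ![a, b, c] d))) ↔
        ¬ (d 0 = d 1 ∧ d 1 = d 2) := by
    rw [← sortedWord_mem_neOrNeLanguage he, ← hL]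
    rfl
  have hs : G.toCFG.IsUseful [.nonterminal G.toCFG.initial] := by
    refine ⟨?_, [], [], id, Function.injective_id, by simp⟩
    by_contra hne
    -- The one-letter word `a` lies in the language, so it has a parse tree.
    have : IsEmpty (G.toCFG.ParseTree G.toCFG.initial
        (sortedWord ![a, b, c] (Finsupp.single 0 1))) := ⟨fun f ↦ hne ⟨f.1⟩⟩
    have h := (hcard (Finsupp.single 0 1)).2 (by simp)
    simp at h
  have h : indicatorSeries (fun d ↦ d 0 = d 1 ∧ d 1 = d 2) =
      indicatorSeries (fun _ ↦ True) -
        ∑ q, ContextFreeGrammar.series ![a, b, c] 0 q [.nonterminal G.toCFG.initial] := by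
    classical
    ext d
    rw [map_sub, ContextFreeGrammar.coeff_sum_series hg he hs, coeff_indicatorSeries,
      coeff_indicatorSeries]
    by_cases hd : d 0 = d 1 ∧ d 1 = d 2
    · have := mt (hcard d).1 (not_not.2 hd)
      rw [Nat.not_odd_iff_even, ← ZMod.natCast_eq_zero_iff_even] at this
      simp [hd, this]
    · have := (hcard d).2 hd
      rw [← ZMod.natCast_eq_one_iff_odd] at this
      simp [hd, this]
  refine indicatorSeries_diagonal_notMem_integralSubring ?_
  rw [h, map_sub, map_sum]
  exact sub_mem (mem_integralSubring_of_mem indicatorSeries_true_mem_regularSubring)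
    (sum_mem fun q _ ↦ ContextFreeGrammar.series_zero_mem_integralSubring hg he q hs)

end PowerSeries

theorem mainTheorem5 {T : Type*} (a b c : T) (hab : a ≠ b) (hac : a ≠ c) (hbc : b ≠ c) :
    (∀ G : GF2Grammar T, G.language ≠ neOrNeLanguage a b c) ∧
      (neOrNeLanguage a b c).IsInherentlyAmbiguous := by
  have he : Function.Injective ![a, b, c] := by
    intro i j h
    fin_cases i <;> fin_cases j <;> simp_all [eq_comm]
  refine ⟨fun G ↦ G.language_ne_neOrNeLanguage he, isContextFree_neOrNeLanguage a b c,
    fun g hL hg ↦ ?_⟩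
  exact hg.toGF2Grammar.language_ne_neOrNeLanguage he (hg.language_toGF2Grammar.trans hL)
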